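/- Let $X$ be the complex Banach space $\ell_p$ ($1\le p<\infty$) or $c_0$ of sequences of complex numbers indexed by $\{0,1,2,\dots\}$, and let $e_n$ denote the $n$-th standard unit vector. Let $(w_n)_{n\ge 0}$ be a sequence of complex numbers with $w_n\to 0$, and let $T$ be the bounded linear operator on $X$ that is the weighted right shift with weights $(w_n)$, i.e. $Te_n=w_ne_{n+1}$ for all $n\ge 0$, equivalently $T(x_0,x_1,x_2,\dots)=(0,w_0x_0,w_1x_1,\dots)$. Then both $T$ and its Banach space adjoint $T^*\colon X^*\to X^*$, $T^*f=f\circ T$, have almost invariant half-spaces. Here a half-space of a Banach space $Z$ is a (norm-)closed linear subspace $Y\subseteq Z$ of infinite dimension and of infinite codimension in $Z$, and $Y$ is almost invariant under a bounded operator $S$ on $Z$ if there is a finite-dimensional subspace $F\subseteq Z$ with $S(Y)\subseteq Y+F$. -/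

import Mathlib

open Filter Topology
open scoped ENNReal ZeroAtInfty

/-- A half-space of a complex normed space `X`: a closed linear subspace of infinite dimension and
of infinite codimension. -/
structure IsHalfSpace {X : Type*} [NormedAddCommGroup X] [NormedSpace ℂ X]
    (Y : Submodule ℂ X) : Prop where
  isClosed : IsClosed (Y : Set X)
  infinite_dim : ¬ FiniteDimensional ℂ Y
  infinite_codim : ¬ FiniteDimensional ℂ (X ⧸ Y)

/-- `Y` is almost invariant under `T`: `T(Y) ⊆ Y + F` for some finite dimensional subspace `F`. -/
def IsAlmostInvariant {X : Type*} [NormedAddCommGroup X] [NormedSpace ℂ X]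
    (T : X →L[ℂ] X) (Y : Submodule ℂ X) : Prop :=
  ∃ F : Submodule ℂ X, FiniteDimensional ℂ F ∧ ∀ y ∈ Y, T y ∈ Y ⊔ F

/-- `T` has an almost invariant half-space. -/
def HasAlmostInvariantHalfSpace {X : Type*} [NormedAddCommGroup X] [NormedSpace ℂ X]
    (T : X →L[ℂ] X) : Prop :=
  ∃ Y : Submodule ℂ X, IsHalfSpace Y ∧ IsAlmostInvariant T Y

/-- The Banach space adjoint `T^* : X^* → X^*`, `T^* f = f ∘ T`, on the dual with its norm. -/
noncomputable def banachAdjoint {X : Type*} [NormedAddCommGroup X] [NormedSpace ℂ X]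
    (T : X →L[ℂ] X) : StrongDual ℂ X →L[ℂ] StrongDual ℂ X :=
  ContinuousLinearMap.precomp ℂ T

/-- The weighted right shift on sequences:
`(x₀, x₁, x₂, …) ↦ (0, w₀ x₀, w₁ x₁, …)`, that is, `eₙ ↦ wₙ eₙ₊₁`. -/
def weightedRightShift (w x : ℕ → ℂ) : ℕ → ℂ
  | 0 => 0
  | n + 1 => w n * x n

/-! ### Duality -/

section Duality

/-! The annihilator of an almost invariant half-space is one for the adjoint, so only `T` needs
work. If infinitely many weights vanish, the basis splits into infinitely many blocks with invariant
span, and the even-numbered blocks give an invariant half-space.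

Otherwise discard an initial segment of length `N`, let `V m` be the product of the first `m`
remaining weights, and put `f j x = ∑ m, c m / V (m + j) * x (m + j + N)`. Then `T^*` sends `f (j +
1)` to `f j`, so on the common kernel of the `f j` only the condition from `f 0` can be lost under
`T`: a one-dimensional error. The codimension is infinite by triangularity. The vectors with
coordinates `z ^ m * V m`, which exist for every `z` because `w → 0`, satisfy `f j = z ^ j * ∑ m, c
m * z ^ m`, so they lie in the kernel when `z` is a zero of the power series. It thus suffices to
find a series with infinitely many zeros and coefficients small enough for the `f j` to be bounded
(`exists_coeff_with_zeros`). -/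

theorem LinearMap.finiteDimensional_quotient_ker {K V W : Type*} [Field K] [AddCommGroup V]
    [Module K V] [AddCommGroup W] [Module K W] [FiniteDimensional K W] (φ : V →ₗ[K] W) :
    FiniteDimensional K (V ⧸ LinearMap.ker φ) :=
  φ.quotKerEquivRange.symm.finiteDimensional

theorem LinearMap.exists_finiteDimensional_sup_ker_eq_top {K V W : Type*} [Field K]
    [AddCommGroup V] [Module K V] [AddCommGroup W] [Module K W] [FiniteDimensional K W]
    (φ : V →ₗ[K] W) : ∃ C : Submodule K V, FiniteDimensional K C ∧ LinearMap.ker φ ⊔ C = ⊤ := by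
  obtain ⟨C, hC⟩ := (LinearMap.ker φ).exists_isCompl
  have := φ.finiteDimensional_quotient_ker
  exact ⟨C, (Submodule.quotientEquivOfIsCompl _ _ hC).finiteDimensional, hC.sup_eq_top⟩

variable {X : Type*} [NormedAddCommGroup X] [NormedSpace ℂ X]

/-- The annihilator of a subspace in the normed dual. -/
def dualAnnihilatorSubmodule (Y : Submodule ℂ X) : Submodule ℂ (StrongDual ℂ X) where
  carrier := {f | ∀ y ∈ Y, f y = 0}
  add_mem' hf hg y hy := by simp [hf y hy, hg y hy]
  zero_mem' y _ := rfl
  smul_mem' c f hf y hy := by simp [hf y hy]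

theorem mem_dualAnnihilatorSubmodule {Y : Submodule ℂ X} {f : StrongDual ℂ X} :
    f ∈ dualAnnihilatorSubmodule Y ↔ ∀ y ∈ Y, f y = 0 := Iff.rfl

theorem isClosed_dualAnnihilatorSubmodule (Y : Submodule ℂ X) :
    IsClosed (dualAnnihilatorSubmodule Y : Set (StrongDual ℂ X)) := by
  have : (dualAnnihilatorSubmodule Y : Set (StrongDual ℂ X)) =
      ⋂ y ∈ Y, {f : StrongDual ℂ X | f y = 0} := by
    ext f
    simp [mem_dualAnnihilatorSubmodule]
  rw [this]
  refine isClosed_biInter fun y _ => ?_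
  exact isClosed_eq (ContinuousLinearMap.apply ℂ ℂ y).continuous continuous_const

theorem exists_mem_dualAnnihilatorSubmodule_ne_zero {Y : Submodule ℂ X}
    (hY : IsClosed (Y : Set X)) {x : X} (hx : x ∉ Y) :
    ∃ f ∈ dualAnnihilatorSubmodule Y, f x ≠ 0 := by
  have : IsClosed (Y : Set X) := hY
  have hx' : Y.mkQ x ≠ 0 := by simpa using hx
  obtain ⟨g, hg⟩ := SeparatingDual.exists_ne_zero (R := ℂ) hx'
  refine ⟨g.comp Y.mkQL, fun y hy => ?_, hg⟩
  have : Y.mkQ y = 0 := by simpa using hy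
  change g (Y.mkQ y) = 0
  rw [this, map_zero]

/-- By Hahn–Banach, `X ⧸ Y` embeds in the algebraic dual of the annihilator, and `Y` in that of the
quotient by the annihilator. -/
theorem IsHalfSpace.dualAnnihilatorSubmodule {Y : Submodule ℂ X} (hY : IsHalfSpace Y) :
    IsHalfSpace (dualAnnihilatorSubmodule Y) where
  isClosed := isClosed_dualAnnihilatorSubmodule Y
  infinite_dim h := by
    let φ : X →ₗ[ℂ] Module.Dual ℂ (_root_.dualAnnihilatorSubmodule Y) :=
      LinearMap.mk₂ ℂ (fun x f => f.1 x) (by simp) (by simp) (by simp) (by simp)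
    have hφ : LinearMap.ker φ = Y := by
      ext x
      rw [LinearMap.mem_ker]
      constructor
      · intro h
        by_contra hx
        obtain ⟨f, hf, hfx⟩ := exists_mem_dualAnnihilatorSubmodule_ne_zero hY.isClosed hx
        exact hfx (LinearMap.congr_fun h ⟨f, hf⟩)
      · intro hx
        ext f
        exact f.2 x hx
    refine hY.infinite_codim ?_
    rw [← hφ]
    have : FiniteDimensional ℂ (Module.Dual ℂ (_root_.dualAnnihilatorSubmodule Y)) :=
      @Subspace.instModuleDualFiniteDimensional ℂ _ _ _ _ h
    exact LinearMap.finiteDimensional_quotient_ker (K := ℂ)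
      (W := Module.Dual ℂ (_root_.dualAnnihilatorSubmodule Y)) φ
  infinite_codim h := by
    let ψ : Y →ₗ[ℂ] Module.Dual ℂ (StrongDual ℂ X ⧸ _root_.dualAnnihilatorSubmodule Y) :=
      { toFun := fun y => (_root_.dualAnnihilatorSubmodule Y).liftQ
          (ContinuousLinearMap.apply ℂ ℂ (y : X)).toLinearMap (fun f hf => hf y y.2)
        map_add' := fun y z => by
          ext f
          exact map_add f (y : X) z
        map_smul' := fun c y => by
          ext f
          exact map_smul f c (y : X) }
    have hψ : Function.Injective ψ := by
      rw [injective_iff_map_eq_zero]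
      intro y hy
      by_contra hne
      have hne' : (y : X) ≠ 0 := by simpa using hne
      obtain ⟨f, hf⟩ := SeparatingDual.exists_ne_zero (R := ℂ) hne'
      exact hf (LinearMap.congr_fun hy (Submodule.Quotient.mk f))
    exact hY.infinite_dim (FiniteDimensional.of_injective ψ hψ)

/-- The adjoint maps functionals vanishing on both `Y` and `F` into the annihilator of `Y`. They
have finite codimension in that annihilator, so the image of a complement `C` serves as error space.
-/
theorem IsAlmostInvariant.dualAnnihilatorSubmodule {T : X →L[ℂ] X} {Y : Submodule ℂ X}
    (h : IsAlmostInvariant T Y) :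
    IsAlmostInvariant (banachAdjoint T) (dualAnnihilatorSubmodule Y) := by
  obtain ⟨F, hF, hTF⟩ := h
  let r : _root_.dualAnnihilatorSubmodule Y →ₗ[ℂ] Module.Dual ℂ F :=
    LinearMap.mk₂ ℂ (fun f x => f.1 x) (by simp) (by simp) (by simp) (by simp)
  obtain ⟨C, hCfin, hC⟩ :=
    LinearMap.exists_finiteDimensional_sup_ker_eq_top (K := ℂ)
      (V := _root_.dualAnnihilatorSubmodule Y) (W := Module.Dual ℂ F) r
  refine ⟨C.map ((banachAdjoint T).toLinearMap ∘ₗ (_root_.dualAnnihilatorSubmodule Y).subtype),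
    inferInstance, fun f hf => ?_⟩
  have hmem : (⟨f, hf⟩ : _root_.dualAnnihilatorSubmodule Y) ∈ LinearMap.ker r ⊔ C := by
    rw [hC]; trivial
  obtain ⟨k, hk, c, hc, hkc⟩ := Submodule.mem_sup.1 hmem
  have hfkc : f = k.1 + c.1 := (congrArg Subtype.val hkc).symm
  rw [hfkc, map_add]
  refine Submodule.add_mem_sup (fun y hy => ?_) ⟨c, hc, rfl⟩
  obtain ⟨y', hy', v, hv, hyv⟩ := Submodule.mem_sup.1 (hTF y hy)
  change k.1 (T y) = 0
  rw [← hyv, map_add, k.2 y' hy', zero_add]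
  exact LinearMap.congr_fun (LinearMap.mem_ker.1 hk) ⟨v, hv⟩

theorem HasAlmostInvariantHalfSpace.banachAdjoint {T : X →L[ℂ] X}
    (h : HasAlmostInvariantHalfSpace T) : HasAlmostInvariantHalfSpace (banachAdjoint T) := by
  obtain ⟨Y, hY, hT⟩ := h
  exact ⟨_, hY.dualAnnihilatorSubmodule, hT.dualAnnihilatorSubmodule⟩

/-- The common kernel of a chain of functionals `f₀, f₁, …` with `T^* fⱼ₊₁ = fⱼ` that is
triangular with respect to a sequence of vectors is almost invariant. -/
theorem hasAlmostInvariantHalfSpace_of_chain (T : X →L[ℂ] X) (f : ℕ → StrongDual ℂ X) (e : ℕ → X)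
    (hfT : ∀ j x, f (j + 1) (T x) = f j x) (hlt : ∀ j k, k < j → f j (e k) = 0)
    (hne : ∀ j, f j (e j) ≠ 0) (u : ℕ → X) (hu : LinearIndependent ℂ u)
    (hfu : ∀ i j, f j (u i) = 0) : HasAlmostInvariantHalfSpace T := by
  let Φ : X →ₗ[ℂ] (ℕ → ℂ) := LinearMap.pi fun j => (f j).toLinearMap
  have hΦ : ∀ x, x ∈ LinearMap.ker Φ ↔ ∀ j, f j x = 0 := fun x => by
    rw [LinearMap.mem_ker, funext_iff]; rfl
  refine ⟨LinearMap.ker Φ, ⟨?_, fun h => ?_, fun h => ?_⟩,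
    Submodule.span ℂ {e 0}, inferInstance, fun y hy => ?_⟩
  · have : (LinearMap.ker Φ : Set X) = ⋂ j, {x | f j x = 0} := by
      ext x
      simpa using hΦ x
    rw [this]
    exact isClosed_iInter fun j => isClosed_eq (f j).continuous continuous_const
  · have hli : LinearIndependent ℂ
        (fun i => (⟨u i, (hΦ _).2 (hfu i)⟩ : LinearMap.ker Φ)) :=
      LinearIndependent.of_comp (LinearMap.ker Φ).subtype hu
    exact not_finite_iff_infinite.2 inferInstance hli.finite
  · let g : ℕ → Module.Dual ℂ (X ⧸ LinearMap.ker Φ) := fun j =>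
      (LinearMap.ker Φ).liftQ (f j).toLinearMap fun x hx => (hΦ x).1 hx j
    have hg : ∀ j x, g j (Submodule.Quotient.mk x) = f j x := fun j x => rfl
    have hli : LinearIndependent ℂ g := by
      rw [linearIndependent_iff']
      intro s c hs i
      induction i using Nat.strong_induction_on with
      | _ i ih =>
        intro hi
        have h1 := LinearMap.congr_fun hs (Submodule.Quotient.mk (e i))
        rw [LinearMap.sum_apply, Finset.sum_eq_single i] at h1
        · simpa [hg, hne i] using h1
        · intro j hj hji
          rcases lt_or_gt_of_ne hji with hlt' | hgt
          · simp [ih j hlt' hj]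
          · simp [hg, hlt j i hgt]
        · exact fun h => absurd hi h
    exact not_finite_iff_infinite.2 inferInstance hli.finite
  · have hsplit : T y = (T y - (f 0 (T y) / f 0 (e 0)) • e 0)
        + (f 0 (T y) / f 0 (e 0)) • e 0 := by abel
    rw [hsplit]
    refine Submodule.add_mem_sup ((hΦ _).2 fun j => ?_)
      (Submodule.smul_mem _ _ (Submodule.mem_span_singleton_self _))
    cases j with
    | zero => simp [hne 0]
    | succ j => simp [hfT, (hΦ y).1 hy j, hlt (j + 1) 0 j.succ_pos]

end Duality

/-! ### Rapidly decreasing power series with infinitely many zeros -/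

/-- If the ratios `ε i` of consecutive coefficients decrease at least like `16 ^ (-i)`, then the
alternating power series with these coefficients changes sign infinitely often. -/
theorem exists_strictMono_zeros (ε : ℕ → ℝ) (hpos : ∀ i, 0 < ε i)
    (hdec : ∀ i, ε (i + 1) ≤ ε i / 16) :
    ∃ z : ℕ → ℝ, StrictMono z ∧
      ∀ i, HasSum (fun m => (-1) ^ m * (∏ l ∈ Finset.range m, ε l) * z i ^ m) 0 := by
  set a : ℕ → ℝ := fun m => ∏ l ∈ Finset.range m, ε l with ha
  have hapos : ∀ m, 0 < a m := fun m => Finset.prod_pos fun l _ => hpos l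
  have hasucc : ∀ m, a (m + 1) = a m * ε m := fun m => Finset.prod_range_succ _ _
  have hanti : Antitone ε := antitone_nat_of_succ_le fun i => by
    linarith [hdec i, hpos i]
  have hεgeo : ∀ i, ε i ≤ ε 0 * (1 / 16) ^ i := fun i => by
    induction i with
    | zero => simp
    | succ i ih => rw [pow_succ]; linarith [hdec i]
  have hεlim : Tendsto ε atTop (𝓝 0) := by
    refine squeeze_zero (fun i => (hpos i).le) hεgeo ?_
    simpa using (tendsto_pow_atTop_nhds_zero_of_lt_one (r := (1 / 16 : ℝ))
      (by norm_num) (by norm_num)).const_mul (ε 0)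
  have hsum : ∀ R : ℝ, 0 ≤ R → Summable fun m => a m * R ^ m := fun R hR => by
    refine summable_of_ratio_norm_eventually_le (r := 1 / 2) (by norm_num) ?_
    have h1 : Tendsto (fun m => ε m * R) atTop (𝓝 0) := by simpa using hεlim.mul_const R
    filter_upwards [h1.eventually_le_const (show (0 : ℝ) < 1 / 2 by norm_num)] with m hm
    have h2 : 0 ≤ a m * R ^ m := mul_nonneg (hapos m).le (pow_nonneg hR m)
    have h3 : a (m + 1) * R ^ (m + 1) = (ε m * R) * (a m * R ^ m) := by rw [hasucc]; ring
    rw [h3, Real.norm_of_nonneg h2,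
      Real.norm_of_nonneg (mul_nonneg (mul_nonneg (hpos m).le hR) h2)]
    exact mul_le_mul_of_nonneg_right hm h2
  have habs : ∀ m x, ‖(-1 : ℝ) ^ m * a m * x ^ m‖ = a m * |x| ^ m := fun m x => by
    rw [norm_mul, norm_mul, norm_pow, norm_pow, norm_neg, norm_one, one_pow, one_mul,
      Real.norm_of_nonneg (hapos m).le, Real.norm_eq_abs]
  have hsumG : ∀ x : ℝ, Summable fun m => (-1) ^ m * a m * x ^ m := fun x =>
    .of_norm (by simpa only [habs] using hsum |x| (abs_nonneg x))
  set G : ℝ → ℝ := fun x => ∑' m, (-1) ^ m * a m * x ^ m with hG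
  have hcont : ∀ p q : ℝ, 0 ≤ p → ContinuousOn G (Set.Icc p q) := fun p q hp => by
    refine continuousOn_tsum (u := fun m => a m * |q| ^ m) (fun m => by fun_prop)
      (hsum _ (abs_nonneg q)) fun m x hx => ?_
    rw [habs]
    have : |x| ≤ |q| := by
      rw [abs_of_nonneg (hp.trans hx.1), abs_of_nonneg (hp.trans (hx.1.trans hx.2))]
      exact hx.2
    exact mul_le_mul_of_nonneg_left (pow_le_pow_left₀ (abs_nonneg x) this m) (hapos m).le
  -- At `x k` the ratio of consecutive terms is at least 4 up to index `k` and, as 16 = 4 · 4, at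
  -- most 1/4 afterwards. Term `k + 1` thus exceeds head plus tail, each at most a third of it, and
  -- fixes the sign.
  set x : ℕ → ℝ := fun k => 4 / ε k with hx
  have hxpos : ∀ k, 0 < x k := fun k => div_pos four_pos (hpos k)
  have hxmono : ∀ k, x k < x (k + 1) := fun k =>
    div_lt_div_of_pos_left four_pos (hpos _) (by linarith [hdec k, hpos k])
  have hsign : ∀ k, 0 < (-1) ^ (k + 1) * G (x k) := fun k => by
    set t : ℕ → ℝ := fun m => a m * x k ^ m with ht
    have htpos : ∀ m, 0 < t m := fun m => mul_pos (hapos m) (pow_pos (hxpos k) m)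
    have htsucc : ∀ m, t (m + 1) = (ε m * x k) * t m := fun m => by
      simp only [ht, hasucc]; ring
    have hup : ∀ m ≤ k, 4 * t m ≤ t (m + 1) := fun m hm => by
      rw [htsucc]
      refine mul_le_mul_of_nonneg_right ?_ (htpos m).le
      rw [hx, mul_div_assoc', le_div_iff₀ (hpos k)]
      linarith [hanti hm]
    have hdown : ∀ m, k + 1 ≤ m → t (m + 1) ≤ t m / 4 := fun m hm => by
      rw [htsucc]
      have : ε m * x k ≤ 1 / 4 := by
        rw [hx, mul_div_assoc', div_le_iff₀ (hpos k)]
        linarith [hanti hm, hdec k]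
      linarith [mul_le_mul_of_nonneg_right this (htpos m).le]
    have hhead : ∀ n ≤ k + 1, ∑ m ∈ Finset.range n, t m ≤ t n / 3 := fun n => by
      induction n with
      | zero => intro _; simpa using div_nonneg (htpos 0).le zero_le_three
      | succ n ih =>
        intro hn
        rw [Finset.sum_range_succ]
        linarith [ih (by omega), hup n (by omega)]
    have htail : ∀ i, t (i + (k + 1 + 1)) ≤ t (k + 1) / 4 * (1 / 4) ^ i := fun i => by
      induction i with
      | zero => simpa using hdown (k + 1) le_rfl
      | succ i ih =>
        have := hdown (i + (k + 1 + 1)) (by omega)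
        rw [show i + 1 + (k + 1 + 1) = i + (k + 1 + 1) + 1 by ring, pow_succ]
        linarith
    have hst : Summable t := hsum _ (hxpos k).le
    have hst' : Summable fun i => t (i + (k + 1 + 1)) := (summable_nat_add_iff _).2 hst
    have hgeo : HasSum (fun i => t (k + 1) / 4 * (1 / 4 : ℝ) ^ i) (t (k + 1) / 3) := by
      have := (hasSum_geometric_of_lt_one (r := (1 / 4 : ℝ)) (by norm_num) (by norm_num)).mul_left
        (t (k + 1) / 4)
      rwa [show t (k + 1) / 4 * (1 - 1 / 4)⁻¹ = t (k + 1) / 3 by ring] at this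
    have htail' : ∑' i, t (i + (k + 1 + 1)) ≤ t (k + 1) / 3 :=
      hgeo.tsum_eq ▸ hst'.tsum_le_tsum htail hgeo.summable
    have hsplit := (hsumG (x k)).sum_add_tsum_nat_add (k + 1 + 1)
    rw [Finset.sum_range_succ] at hsplit
    have hterm : ∀ m, ‖(-1 : ℝ) ^ m * a m * x k ^ m‖ = t m := fun m => by
      rw [habs, abs_of_pos (hxpos k)]
    have hA : |∑ m ∈ Finset.range (k + 1), (-1) ^ m * a m * x k ^ m| ≤ t (k + 1) / 3 := by
      refine (Finset.abs_sum_le_sum_abs _ _).trans ?_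
      simp only [← Real.norm_eq_abs, hterm]
      exact hhead _ le_rfl
    have hB : |∑' i, (-1) ^ (i + (k + 1 + 1)) * a (i + (k + 1 + 1)) * x k ^ (i + (k + 1 + 1))|
        ≤ t (k + 1) / 3 := by
      refine le_trans ?_ htail'
      rw [← Real.norm_eq_abs]
      exact tsum_of_norm_bounded hst'.hasSum fun i => (hterm _).le
    have hC : (-1 : ℝ) ^ (k + 1) * ((-1) ^ (k + 1) * a (k + 1) * x k ^ (k + 1)) = t (k + 1) := by
      rw [mul_assoc ((-1 : ℝ) ^ (k + 1)), ← mul_assoc, ← mul_pow]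
      simp [ht]
    have hneg : ∀ y : ℝ, -|y| ≤ (-1) ^ (k + 1) * y := fun y => by
      have := neg_abs_le ((-1 : ℝ) ^ (k + 1) * y)
      rwa [abs_mul, abs_pow, abs_neg, abs_one, one_pow, one_mul] at this
    change 0 < (-1) ^ (k + 1) * ∑' m, (-1) ^ m * a m * x k ^ m
    rw [← hsplit, mul_add, mul_add, hC]
    linarith [hneg (∑ m ∈ Finset.range (k + 1), (-1) ^ m * a m * x k ^ m),
      hneg (∑' i, (-1) ^ (i + (k + 1 + 1)) * a (i + (k + 1 + 1)) * x k ^ (i + (k + 1 + 1))),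
      htpos (k + 1)]
  have hzero : ∀ k, ∃ y ∈ Set.Ioo (x k) (x (k + 1)), G y = 0 := fun k => by
    have h1 := hsign k
    have h2 := hsign (k + 1)
    rw [pow_succ (-1 : ℝ) (k + 1)] at h2
    have hc := hcont (x k) (x (k + 1)) (hxpos k).le
    rcases neg_one_pow_eq_or ℝ (k + 1) with h | h
    · rw [h] at h1 h2
      exact intermediate_value_Ioo' (hxmono k).le hc ⟨by linarith, by linarith⟩
    · rw [h] at h1 h2
      exact intermediate_value_Ioo (hxmono k).le hc ⟨by linarith, by linarith⟩
  choose z hz hGz using hzero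
  refine ⟨z, strictMono_nat_of_lt_succ fun k => (hz k).2.trans (hz (k + 1)).1, fun i => ?_⟩
  have := (hsumG (z i)).hasSum
  rwa [show ∑' m, (-1) ^ m * a m * z i ^ m = 0 from hGz i] at this

/-- For every sequence of nonzero numbers `V` there is a power series with infinitely many
zeros whose coefficients stay summable after division by any shift of `V`. -/
theorem exists_coeff_with_zeros (V : ℕ → ℂ) (hV : ∀ n, V n ≠ 0) :
    ∃ c : ℕ → ℂ, c 0 = 1 ∧ (∀ j, Summable fun m => ‖c m / V (m + j)‖) ∧
      ∃ z : ℕ → ℂ, Function.Injective z ∧ ∀ i, HasSum (fun m => c m * z i ^ m) 0 := by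
  set δ : ℕ → ℝ := fun n => ∏ l ∈ Finset.range n, min 1 ‖V l‖ with hδ
  have hmin : ∀ l, 0 < min 1 ‖V l‖ := fun l => lt_min one_pos (norm_pos_iff.2 (hV l))
  have hδpos : ∀ n, 0 < δ n := fun n => Finset.prod_pos fun l _ => hmin l
  have hδanti : Antitone δ := antitone_nat_of_succ_le fun n => by
    rw [hδ]
    simp only [Finset.prod_range_succ]
    exact mul_le_of_le_one_right (hδpos n).le (min_le_left _ _)
  have hδone : ∀ n, δ n ≤ 1 := fun n => by simpa [hδ] using hδanti n.zero_le
  have hδle : ∀ l n, l < n → δ n ≤ ‖V l‖ := fun l n hln => by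
    refine (hδanti (Nat.succ_le_of_lt hln)).trans ?_
    rw [hδ]
    simp only [Nat.succ_eq_add_one, Finset.prod_range_succ]
    exact (mul_le_of_le_one_left (hmin l).le (hδone l)).trans (min_le_right _ _)
  -- For `m ≥ j + 1`, the coefficient `a m` is at most `ε (m - 1)`, which contains `δ (2 * m + 1)`;
  -- this is at most `‖V (m + j)‖` since `m + j < 2 * m + 1`. The geometric factor remains for
  -- summability.
  set ε : ℕ → ℝ := fun i => (1 / 16) ^ i * δ (2 * i + 3) with hε
  have hεpos : ∀ i, 0 < ε i := fun i => mul_pos (by positivity) (hδpos _)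
  have hεone : ∀ i, ε i ≤ 1 := fun i =>
    mul_le_one₀ (pow_le_one₀ (by norm_num) (by norm_num)) (hδpos _).le (hδone _)
  have hεdec : ∀ i, ε (i + 1) ≤ ε i / 16 := fun i => by
    have h1 : δ (2 * (i + 1) + 3) ≤ δ (2 * i + 3) := hδanti (by omega)
    have h2 := mul_le_mul_of_nonneg_left h1 (show (0 : ℝ) ≤ (1 / 16) ^ i by positivity)
    simp only [hε, pow_succ]
    linarith
  obtain ⟨z, hzmono, hz⟩ := exists_strictMono_zeros ε hεpos hεdec
  set a : ℕ → ℝ := fun m => ∏ l ∈ Finset.range m, ε l with ha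
  have hapos : ∀ m, 0 < a m := fun m => Finset.prod_pos fun l _ => hεpos l
  have haone : ∀ m, a m ≤ 1 := fun m =>
    Finset.prod_le_one (fun l _ => (hεpos l).le) fun l _ => hεone l
  refine ⟨fun m => (((-1) ^ m * a m : ℝ) : ℂ), by simp [ha], fun j => ?_,
    fun i => (z i : ℂ), Complex.ofReal_injective.comp hzmono.injective, fun i => ?_⟩
  · rw [← summable_nat_add_iff (j + 1)]
    refine Summable.of_nonneg_of_le (fun _ => norm_nonneg _) (fun i => ?_)
      (summable_geometric_of_lt_one (r := (1 / 16 : ℝ)) (by norm_num) (by norm_num))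
    rw [norm_div, Complex.norm_real, norm_mul, norm_pow, norm_neg, norm_one, one_pow, one_mul,
      Real.norm_of_nonneg (hapos _).le, div_le_iff₀ (norm_pos_iff.2 (hV _))]
    have h1 : a (i + (j + 1)) ≤ ε (i + j) := by
      rw [ha, ← add_assoc]
      simp only [Finset.prod_range_succ]
      exact mul_le_of_le_one_left (hεpos _).le (haone _)
    refine h1.trans (mul_le_mul ?_ (hδle _ _ (by omega)) (hδpos _).le (by positivity))
    exact pow_le_pow_of_le_one (by norm_num) (by norm_num) (by omega)
  · have := Complex.hasSum_ofReal.2 (hz i)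
    simpa [ha] using this

/-! ### Weighted shifts on spaces of sequences -/

section Shift

variable {X : Type*} [NormedAddCommGroup X] [NormedSpace ℂ X]

theorem exists_strongDual_hasSum (ev : X →ₗ[ℂ] (ℕ → ℂ)) (hle : ∀ x n, ‖ev x n‖ ≤ ‖x‖)
    (c : ℕ → ℂ) (hc : Summable fun m => ‖c m‖) (s : ℕ) :
    ∃ f : StrongDual ℂ X, ∀ x, HasSum (fun m => c m * ev x (m + s)) (f x) := by
  have hb : ∀ x m, ‖c m * ev x (m + s)‖ ≤ ‖c m‖ * ‖x‖ := fun x m => by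
    rw [norm_mul]
    exact mul_le_mul_of_nonneg_left (hle x _) (norm_nonneg _)
  have hs : ∀ x, Summable fun m => c m * ev x (m + s) := fun x =>
    .of_norm_bounded (hc.mul_right ‖x‖) (hb x)
  let g : X →ₗ[ℂ] ℂ :=
    { toFun := fun x => ∑' m, c m * ev x (m + s)
      map_add' := fun x y => by
        rw [← (hs x).tsum_add (hs y)]
        simp [mul_add]
      map_smul' := fun r x => by
        rw [RingHom.id_apply, smul_eq_mul, ← tsum_mul_left]
        simp [mul_left_comm] }
  exact ⟨g.mkContinuous (∑' m, ‖c m‖) fun x =>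
    tsum_of_norm_bounded (hc.hasSum.mul_right ‖x‖) (hb x), fun x => (hs x).hasSum⟩

/-- Geometric sequences are eigenvectors of the left shift with distinct eigenvalues. -/
theorem linearIndependent_geometric {z : ℕ → ℂ} (hz : Function.Injective z) :
    LinearIndependent ℂ fun i (m : ℕ) => z i ^ m := by
  refine Module.End.eigenvectors_linearIndependent' (LinearMap.funLeft ℂ ℂ Nat.succ) z hz _
    fun i => Module.End.hasEigenvector_iff.2 ⟨Module.End.mem_eigenspace_iff.2 ?_, fun h => ?_⟩
  · ext m
    simp [LinearMap.funLeft_apply, pow_succ']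
  · simpa using congrFun h 0

theorem hasAlmostInvariantHalfSpace_of_infinite_zeros (ev : X →ₗ[ℂ] (ℕ → ℂ))
    (hle : ∀ x n, ‖ev x n‖ ≤ ‖x‖)
    (hsurj : ∀ a : ℕ → ℂ, (Summable fun n => ‖a n‖) → ∃ x, ev x = a)
    (w : ℕ → ℂ) (T : X →L[ℂ] X) (hT : ∀ x n, ev (T x) n = weightedRightShift w (ev x) n)
    (hinf : {n | w n = 0}.Infinite) : HasAlmostInvariantHalfSpace T := by
  classical
  -- `κ n` is the number of the block containing `n`; a block ends at each zero of `w`.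
  set κ : ℕ → ℕ := Nat.count (fun n => w n = 0) with hκ
  have hκnth : ∀ n, κ (Nat.nth (fun n => w n = 0) n) = n := Nat.count_nth_of_infinite hinf
  have hunit : ∀ n, ∃ x, ev x = Pi.single n 1 := fun n => by
    refine hsurj _ (summable_of_ne_finset_zero (s := {n}) fun m hm => ?_)
    rw [Pi.single_eq_of_ne (by simpa using hm), norm_zero]
  choose e he using hunit
  have hinj : ∀ r : ℕ, Function.Injective
      fun i => Nat.nth (fun n => w n = 0) (2 * i + r) := fun r i j hij => by
    have := congrArg κ hij
    simp only [hκnth] at this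
    omega
  -- The kernel consists of the vectors supported on even-numbered blocks.
  let Φ : X →ₗ[ℂ] (ℕ → ℂ) :=
    LinearMap.pi fun n => if Even (κ n) then 0 else LinearMap.proj n ∘ₗ ev
  have hΦ : ∀ x, x ∈ LinearMap.ker Φ ↔ ∀ n, ¬ Even (κ n) → ev x n = 0 := fun x => by
    rw [LinearMap.mem_ker, funext_iff]
    refine forall_congr' fun n => ?_
    by_cases h : Even (κ n) <;> simp [Φ, h]
  have hli : LinearIndependent ℂ fun n : ℕ => (Pi.single n 1 : ℕ → ℂ) :=
    Pi.linearIndependent_single_one ℕ ℂ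
  refine ⟨LinearMap.ker Φ, ⟨?_, fun h => ?_, fun h => ?_⟩, ⊥, inferInstance, fun y hy => ?_⟩
  · have hset : (LinearMap.ker Φ : Set X) = ⋂ n, ⋂ (_ : ¬ Even (κ n)), {x | ev x n = 0} := by
      ext x
      simpa using hΦ x
    rw [hset]
    refine isClosed_iInter fun n => isClosed_iInter fun _ => isClosed_eq ?_ continuous_const
    exact ((LinearMap.proj n ∘ₗ ev).mkContinuous 1 fun x => by simpa using hle x n).continuous
  · have hmem : ∀ i, e (Nat.nth (fun n => w n = 0) (2 * i + 0)) ∈ LinearMap.ker Φ := fun i => by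
      refine (hΦ _).2 fun n hn => ?_
      rw [he, Pi.single_eq_of_ne]
      rintro rfl
      exact hn (by rw [hκnth]; simp)
    have : LinearIndependent ℂ
        fun i => (⟨e (Nat.nth (fun n => w n = 0) (2 * i + 0)), hmem i⟩ : LinearMap.ker Φ) := by
      refine LinearIndependent.of_comp (ev ∘ₗ (LinearMap.ker Φ).subtype) ?_
      convert hli.comp _ (hinj 0) using 1
      ext1 i
      exact he _
    exact not_finite_iff_infinite.2 inferInstance this.finite
  · have hval : ∀ i, Φ (e (Nat.nth (fun n => w n = 0) (2 * i + 1))) =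
        Pi.single (Nat.nth (fun n => w n = 0) (2 * i + 1)) 1 := fun i => by
      ext n
      by_cases hn : Even (κ n)
      · have : n ≠ Nat.nth (fun n => w n = 0) (2 * i + 1) := by
          rintro rfl
          rw [hκnth] at hn
          exact absurd hn (by simp)
        simp [Φ, hn, this]
      · simp [Φ, hn, he]
    have : LinearIndependent ℂ fun i =>
        (LinearMap.ker Φ).mkQ (e (Nat.nth (fun n => w n = 0) (2 * i + 1))) := by
      refine LinearIndependent.of_comp ((LinearMap.ker Φ).liftQ Φ le_rfl) ?_
      have hcomp : (LinearMap.ker Φ).liftQ Φ le_rfl ∘ (fun i =>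
          (LinearMap.ker Φ).mkQ (e (Nat.nth (fun n => w n = 0) (2 * i + 1)))) =
          (fun n : ℕ => (Pi.single n 1 : ℕ → ℂ)) ∘
            fun i => Nat.nth (fun n => w n = 0) (2 * i + 1) := funext hval
      rw [hcomp]
      exact hli.comp _ (hinj 1)
    exact not_finite_iff_infinite.2 inferInstance this.finite
  · rw [sup_bot_eq]
    refine (hΦ _).2 fun n hn => ?_
    rw [hT]
    cases n with
    | zero => rfl
    | succ n =>
      change w n * ev y n = 0
      by_cases hw : w n = 0
      · rw [hw, zero_mul]
      · have : κ (n + 1) = κ n := by simp [hκ, Nat.count_succ, hw]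
        rw [(hΦ y).1 hy n (this ▸ hn), mul_zero]

theorem hasAlmostInvariantHalfSpace_of_eventually_ne_zero (ev : X →ₗ[ℂ] (ℕ → ℂ))
    (hle : ∀ x n, ‖ev x n‖ ≤ ‖x‖)
    (hsurj : ∀ a : ℕ → ℂ, (Summable fun n => ‖a n‖) → ∃ x, ev x = a)
    (w : ℕ → ℂ) (hw : Tendsto w atTop (𝓝 0)) (T : X →L[ℂ] X)
    (hT : ∀ x n, ev (T x) n = weightedRightShift w (ev x) n)
    (N : ℕ) (hN : ∀ n, w (n + N) ≠ 0) : HasAlmostInvariantHalfSpace T := by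
  set V : ℕ → ℂ := fun m => ∏ l ∈ Finset.range m, w (l + N) with hV
  have hVne : ∀ m, V m ≠ 0 := fun m => Finset.prod_ne_zero_iff.2 fun l _ => hN l
  have hVsucc : ∀ m, V (m + 1) = V m * w (m + N) := fun m => Finset.prod_range_succ _ _
  obtain ⟨c, hc0, hcs, z, hzinj, hz⟩ := exists_coeff_with_zeros V hVne
  choose f hf using fun j => exists_strongDual_hasSum ev hle _ (hcs j) (j + N)
  have hunit : ∀ n, ∃ x, ev x = Pi.single n 1 := fun n => by
    refine hsurj _ (summable_of_ne_finset_zero (s := {n}) fun m hm => ?_)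
    rw [Pi.single_eq_of_ne (by simpa using hm), norm_zero]
  choose e he using hunit
  have hgeo : ∀ i, ∃ x, ∀ m, ev x (m + N) = z i ^ m * V m := fun i => by
    have hs : Summable fun m => z i ^ m * V m := by
      refine summable_of_ratio_norm_eventually_le (r := 1 / 2) (by norm_num) ?_
      have h1 : Tendsto (fun m => ‖z i * w (m + N)‖) atTop (𝓝 0) := by
        -- The decay of the weights makes the ratios tend to zero whatever the size of `z i`.
        simpa using ((hw.comp (tendsto_add_atTop_nat N)).const_mul (z i)).norm
      filter_upwards [h1.eventually_le_const (show (0 : ℝ) < 1 / 2 by norm_num)] with m hm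
      rw [hVsucc, show z i ^ (m + 1) * (V m * w (m + N)) =
        (z i * w (m + N)) * (z i ^ m * V m) by ring, norm_mul]
      exact mul_le_mul_of_nonneg_right hm (norm_nonneg _)
    obtain ⟨x, hx⟩ := hsurj (fun n => if n < N then 0 else z i ^ (n - N) * V (n - N)) (by
      rw [← summable_nat_add_iff N]
      simpa using hs.norm)
    exact ⟨x, fun m => by simp [hx]⟩
  choose u hu using hgeo
  have hsingle : ∀ j k, HasSum
      (fun m => c m / V (m + j) * (Pi.single (k + N) 1 : ℕ → ℂ) (m + (j + N))) (f j (e (k + N))) :=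
    fun j k => by simpa only [he] using hf j (e (k + N))
  refine hasAlmostInvariantHalfSpace_of_chain T f (fun k => e (k + N)) (fun j x => ?_)
    (fun j k hkj => ?_) (fun j => ?_) u ?_ (fun i j => ?_)
  · refine (hf (j + 1) (T x)).unique ?_
    convert hf j x using 2 with m
    rw [hT, show m + (j + 1 + N) = m + (j + N) + 1 by ring]
    change c m / V (m + j + 1) * (w (m + (j + N)) * ev x (m + (j + N))) = _
    rw [hVsucc, ← add_assoc m j N, ← mul_assoc, div_mul_eq_mul_div,
      mul_div_mul_right _ _ (hN (m + j))]
  · refine (hsingle j k).unique ?_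
    convert hasSum_zero using 2 with m
    rw [Pi.single_eq_of_ne (by omega), mul_zero]
  · have : f j (e (j + N)) = 1 / V j := by
      refine (hsingle j j).unique ?_
      convert hasSum_single (f := fun m => c m / V (m + j) *
        (Pi.single (j + N) 1 : ℕ → ℂ) (m + (j + N))) 0 (fun m hm => ?_) using 1
      · simp [hc0]
      · rw [Pi.single_eq_of_ne (by omega), mul_zero]
    rw [this]
    exact one_div_ne_zero (hVne j)
  · let ψ : (ℕ → ℂ) →ₗ[ℂ] (ℕ → ℂ) :=
      LinearMap.pi fun m => (V m)⁻¹ • LinearMap.proj (m + N)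
    refine LinearIndependent.of_comp (ψ ∘ₗ ev) ?_
    convert linearIndependent_geometric hzinj using 1
    ext i m
    simp [ψ, hu, mul_comm (z i ^ m), hVne m]
  · refine (hf j (u i)).unique ?_
    have := (hz i).mul_left (z i ^ j)
    rw [mul_zero] at this
    have hterm : (fun m => c m / V (m + j) * ev (u i) (m + (j + N))) =
        fun m => z i ^ j * (c m * z i ^ m) := by
      ext m
      rw [← add_assoc, hu, pow_add]
      field_simp [hVne (m + j)]
    rwa [hterm]

/-- Treats all the spaces at once: the argument needs only contractive coordinates and all
absolutely summable sequences. -/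
theorem hasAlmostInvariantHalfSpace_weightedRightShift (ev : X →ₗ[ℂ] (ℕ → ℂ))
    (hle : ∀ x n, ‖ev x n‖ ≤ ‖x‖)
    (hsurj : ∀ a : ℕ → ℂ, (Summable fun n => ‖a n‖) → ∃ x, ev x = a)
    (w : ℕ → ℂ) (hw : Tendsto w atTop (𝓝 0)) (T : X →L[ℂ] X)
    (hT : ∀ x n, ev (T x) n = weightedRightShift w (ev x) n) :
    HasAlmostInvariantHalfSpace T := by
  by_cases hinf : {n | w n = 0}.Infinite
  · exact hasAlmostInvariantHalfSpace_of_infinite_zeros ev hle hsurj w T hT hinf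
  · obtain ⟨B, hB⟩ := (Set.not_infinite.1 hinf).bddAbove
    refine hasAlmostInvariantHalfSpace_of_eventually_ne_zero ev hle hsurj w hw T hT (B + 1)
      fun n hn => ?_
    have : n + (B + 1) ≤ B := hB hn
    omega

end Shift

/-- The space `c₀` is `C₀(ℕ, ℂ)`: the functions on the discrete space `ℕ` that vanish at infinity,
with the supremum norm. -/
theorem corollary3p4 (w : ℕ → ℂ) (hw : Tendsto w atTop (𝓝 0)) :
    (∀ (p : ℝ≥0∞) [Fact (1 ≤ p)], p ≠ ∞ →
      ∀ T : lp (fun _ : ℕ => ℂ) p →L[ℂ] lp (fun _ : ℕ => ℂ) p,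
        (∀ (x : lp (fun _ : ℕ => ℂ) p) (n : ℕ), (T x) n = weightedRightShift w x n) →
          HasAlmostInvariantHalfSpace T ∧ HasAlmostInvariantHalfSpace (banachAdjoint T)) ∧
    (∀ T : C₀(ℕ, ℂ) →L[ℂ] C₀(ℕ, ℂ),
        (∀ (x : C₀(ℕ, ℂ)) (n : ℕ), (T x) n = weightedRightShift w x n) →
          HasAlmostInvariantHalfSpace T ∧ HasAlmostInvariantHalfSpace (banachAdjoint T)) := by
  constructor
  · intro p hp _ T hT
    have hp0 : p ≠ 0 := (zero_lt_one.trans_le hp.out).ne'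
    let ev : lp (fun _ : ℕ => ℂ) p →ₗ[ℂ] (ℕ → ℂ) :=
      { toFun := fun x => x
        map_add' := fun _ _ => rfl
        map_smul' := fun _ _ => rfl }
    have h := hasAlmostInvariantHalfSpace_weightedRightShift ev
      (fun x n => lp.norm_apply_le_norm hp0 x n)
      (fun a ha => ⟨⟨a, Memℓp.of_exponent_ge
        (memℓp_gen (p := 1) (by simpa using ha)) hp.out⟩, rfl⟩) w hw T hT
    exact ⟨h, h.banachAdjoint⟩
  · intro T hT
    let ev : C₀(ℕ, ℂ) →ₗ[ℂ] (ℕ → ℂ) :=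
      { toFun := fun x => x
        map_add' := fun _ _ => rfl
        map_smul' := fun _ _ => rfl }
    have h := hasAlmostInvariantHalfSpace_weightedRightShift ev
      (fun x n => x.toBCF.norm_coe_le_norm n)
      (fun a ha => ⟨⟨⟨a, continuous_of_discreteTopology⟩, by
        rw [Filter.cocompact_eq_cofinite]
        exact tendsto_zero_iff_norm_tendsto_zero.2 ha.tendsto_cofinite_zero⟩, rfl⟩) w hw T hT
    exact ⟨h, h.banachAdjoint⟩
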